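/- Let $0\le J\le M$ and $L\ge 0$ be integers, let $X_1,\dots,X_M,S,V$ be random variables with finite alphabets $\mathcal X_1,\dots,\mathcal X_M,\mathcal S,\mathcal V$ and arbitrary joint distribution $p(x_{\{1,\dots,M\}},s,v)$, and let $d_l:\mathcal V\times\hat{\mathcal V}_l\to[0,d_{l\max}]$, $1\le l\le L$, be bounded distortion measures such that for every probability vector $\mu$ on $\mathcal V$ the minimum over $\hat v\in\hat{\mathcal V}_l$ of $\sum_v\mu(v)d_l(v,\hat v)$ is attained (for example, $\hat{\mathcal V}_l$ is finite and non-empty). For test channels $\{q_k(z_k|x_k)\}_{k=J+1}^M$ with finite alphabets $\mathcal Z_k$, let $(X_{\{1,\dots,M\}},S,V,Z_{\{J+1,\dots,M\}})$ have the joint distribution $p(x_{\{1,\dots,M\}},s,v)\prod_{k=J+1}^M q_k(z_k|x_k)$, and put $Z_m=X_m$ for $1\le m\le J$. Let $\mathcal A_1^*$ be the set of vectors $(R_{\{1,\dots,M\}},D_{\{1,\dots,L\}})\in\mathbb R^{M+L}$ for which there are such test channels with $$I(X_I;Z_I|Z_{I^c},S)\le\sum_{i\in I}R_i\quad\text{for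 all }\emptyset\ne I\subseteq\{1,\dots,M\},$$ and maps $\psi_l:\mathcal X_1\times\dots\times\mathcal X_J\times\mathcal Z_{J+1}\times\dots\times\mathcal Z_M\times\mathcal S\to\hat{\mathcal V}_l$ with $\mathrm E\,d_l(V,\psi_l(X_{\{1,\dots,J\}},Z_{\{J+1,\dots,M\}},S))\le D_l$ for $1\le l\le L$. For a permutation $\pi$ of $\{1,\dots,M\}$ and test channels $\{q_k\}$, define $$R^\pi_{\pi(i)}(\{q_k\})=I(X_{\pi(i)};Z_{\pi(i)}|Z_{\pi(1)},\dots,Z_{\pi(i-1)},S)\quad(1\le i\le M),$$ $$D^\pi_l(\{q_k\})=\min_{\psi_l}\mathrm E\,d_l(V,\psi_l(X_{\{1,\dots,J\}},Z_{\{J+1,\dots,M\}},S))\quad(1\le l\le L),$$ $$\mathcal A_{1;\pi}^*=\bigcup_{\{q_k\}}\{(R,D):R_i\ge R_i^\pi(\{q_k\})\ (1\le i\le M),\ D_l\ge D_l^\pi(\{q_k\})\ (1\le l\le L)\},$$ the union being over all families of test channels with finite alphabets. A point of a set $A\subseteq\mathbb R^{M+L}$, convex or not, is called an extreme point of $A$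 if it is not in the open segment between two distinct points of $A$. Then: 1. For each permutation $\pi$, every extreme point of $\mathcal A_{1;\pi}^*$ equals $(R^\pi(\{q_k\}),D^\pi(\{q_k\}))$ for some test channels $\{q_k\}$ with alphabet sizes $|\mathcal Z_k|\le|\mathcal X_k|$, $J+1\le k\le M$. 2. $\mathrm{conv}(\mathcal A_1^*)=\mathrm{conv}\bigl(\bigcup_\pi\mathcal A_{1;\pi}^*\bigr)$. 3. Every extreme point of $\mathcal A_1^*$ is an extreme point of $\mathcal A_{1;\pi}^*$ for some permutation $\pi$. (Hence, by 1, every extreme point of $\mathcal A_1^*$ is attained by auxiliary variables with $|\mathcal Z_k|\le|\mathcal X_k|$.) -/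

import Mathlib

open scoped BigOperators

namespace CanonicalBound

noncomputable section

/-- Probability that the random variable `f` takes the value `a`, on a finite sample space with
probability mass function `P`. -/
def prob {Ω α : Type*} [Fintype Ω] (P : Ω → ℝ) (f : Ω → α) (a : α) : ℝ :=
  open Classical in ∑ ω, if f ω = a then P ω else 0

/-- Shannon entropy `H(f)` (in nats). -/
def entropy {Ω α : Type*} [Fintype Ω] [Fintype α] (P : Ω → ℝ) (f : Ω → α) : ℝ :=
  ∑ a, Real.negMulLog (prob P f a)

/-- Conditional entropy `H(f | g) = H(f, g) - H(g)`. -/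
def condEntropy {Ω α β : Type*} [Fintype Ω] [Fintype α] [Fintype β]
    (P : Ω → ℝ) (f : Ω → α) (g : Ω → β) : ℝ :=
  entropy P (fun ω => (f ω, g ω)) - entropy P g

/-- Conditional mutual information `I(f ; g | h) = H(f | h) - H(f | g, h)`. -/
def condMutualInfo {Ω α β γ : Type*} [Fintype Ω] [Fintype α] [Fintype β] [Fintype γ]
    (P : Ω → ℝ) (f : Ω → α) (g : Ω → β) (h : Ω → γ) : ℝ :=
  condEntropy P f h - condEntropy P f (fun ω => (g ω, h ω))

/-- Indices of the sources `X_k` that have a genuine auxiliary variable. Sources are indexed from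
`0`, so these are `k = J, …, M - 1`; for the first `J` indices, `Z_k = X_k`. -/
abbrev AuxIdx (M J : ℕ) : Type := {k : Fin M // J ≤ k.val}

/-- Indices of the first `J` sources. -/
abbrev DirectIdx (M J : ℕ) : Type := {k : Fin M // k.val < J}

variable {M L J : ℕ} {X : Fin M → Type*} {S V : Type*} {W : Fin L → Type*}

/-- The sample space of `(X_1, …, X_M, S, V)` and the auxiliary variables `Z_{J+1}, …, Z_M`, where
`Z_k` has the alphabet `Fin (n k)` of size `n k` (`n k` is not used for the first `J` indices). -/
abbrev Outcome (J : ℕ) (X : Fin M → Type*) (S V : Type*) (n : Fin M → ℕ) : Type _ :=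
  ((∀ k, X k) × S × V) × (∀ k : AuxIdx M J, Fin (n k))

/-- `q` is a family of test channels: `q k x` is the law of `Z_k` given `X_k = x`. -/
def IsTestChannel {n : Fin M → ℕ} (q : ∀ k : AuxIdx M J, X k → Fin (n k) → ℝ) : Prop :=
  ∀ (k : AuxIdx M J) (x : X k), q k x ∈ stdSimplex ℝ (Fin (n k))

/-- The joint distribution `p(x, s, v) ∏_k q_k(z_k | x_k)`. -/
def joint {n : Fin M → ℕ} (p : (∀ k, X k) × S × V → ℝ)
    (q : ∀ k : AuxIdx M J, X k → Fin (n k) → ℝ) (ω : Outcome J X S V n) : ℝ :=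
  p ω.1 * ∏ k : AuxIdx M J, q k (ω.1.1 k.1) (ω.2 k)

/-- The random vector `X_I`. -/
def xVec (n : Fin M → ℕ) (I : Finset (Fin M)) (ω : Outcome J X S V n) (k : I) : X k :=
  ω.1.1 k

/-- The random vector `Z_I`, with `Z_k = X_k` for the first `J` indices. Both kinds of values are
held in the disjoint union of `X k` and `Fin (n k)`: only the left summand occurs for the first `J`
indices, and only the right summand, of size `n k`, for the others. -/
def zVec (n : Fin M → ℕ) (I : Finset (Fin M)) (ω : Outcome J X S V n) (k : I) :
    X k ⊕ Fin (n k) :=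
  if h : J ≤ k.val.val then Sum.inr (ω.2 ⟨k, h⟩) else Sum.inl (ω.1.1 k)

/-- The side information `S` as a random variable. -/
def sVar (n : Fin M → ℕ) (ω : Outcome J X S V n) : S := ω.1.2.1

/-- Reconstruction mappings `ψ(x_1, …, x_J, z_{J+1}, …, z_M, s)` with values in `T`. -/
abbrev Decoder (J : ℕ) (X : Fin M → Type*) (S : Type*) (n : Fin M → ℕ) (T : Type*) : Type _ :=
  (∀ k : DirectIdx M J, X k) → (∀ k : AuxIdx M J, Fin (n k)) → S → T

variable [∀ k, Fintype (X k)] [Fintype S] [Fintype V]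

/-- The mutual information `I(X_I ; Z_I | Z_C, S)`. -/
def infoGiven {n : Fin M → ℕ} (p : (∀ k, X k) × S × V → ℝ)
    (q : ∀ k : AuxIdx M J, X k → Fin (n k) → ℝ) (I C : Finset (Fin M)) : ℝ :=
  condMutualInfo (joint p q) (xVec n I) (zVec n I) (fun ω => (zVec n C ω, sVar n ω))

/-- The expected distortion `E d(V, ψ(X_1, …, X_J, Z_{J+1}, …, Z_M, S))`. -/
def expDist {n : Fin M → ℕ} {T : Type*} (p : (∀ k, X k) × S × V → ℝ) (d : V → T → ℝ)
    (q : ∀ k : AuxIdx M J, X k → Fin (n k) → ℝ) (ψ : Decoder J X S n T) : ℝ :=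
  ∑ ω : Outcome J X S V n,
    joint p q ω * d ω.1.2.2 (ψ (fun k => ω.1.1 k) ω.2 ω.1.2.1)

/-- The region `A_1^*({q_k})` of rate-distortion vectors for fixed test channels. -/
def channelRegion {n : Fin M → ℕ} (p : (∀ k, X k) × S × V → ℝ) (d : ∀ l, V → W l → ℝ)
    (q : ∀ k : AuxIdx M J, X k → Fin (n k) → ℝ) : Set ((Fin M → ℝ) × (Fin L → ℝ)) :=
  {y | (∀ I : Finset (Fin M), I.Nonempty → infoGiven p q I Iᶜ ≤ ∑ i ∈ I, y.1 i) ∧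
    ∀ l, ∃ ψ : Decoder J X S n (W l), expDist p (d l) q ψ ≤ y.2 l}

/-- The canonical inner bound `A_1^*`. -/
def canonicalRegion (J : ℕ) (p : (∀ k, X k) × S × V → ℝ) (d : ∀ l, V → W l → ℝ) :
    Set ((Fin M → ℝ) × (Fin L → ℝ)) :=
  {y | ∃ (n : Fin M → ℕ) (q : ∀ k : AuxIdx M J, X k → Fin (n k) → ℝ),
    IsTestChannel q ∧ y ∈ channelRegion p d q}

/-- The corner point `(R^π({q_k}), D^π({q_k}))`. With `k = π i`, its rates are
`R^π_k = I(X_k ; Z_k | Z_{π 1}, …, Z_{π (i - 1)}, S)`; its distortions are the minimum expected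
distortions. -/
def corner {n : Fin M → ℕ} (p : (∀ k, X k) × S × V → ℝ) (d : ∀ l, V → W l → ℝ)
    (q : ∀ k : AuxIdx M J, X k → Fin (n k) → ℝ) (π : Equiv.Perm (Fin M)) :
    (Fin M → ℝ) × (Fin L → ℝ) :=
  (fun k => infoGiven p q {k} (Finset.univ.filter fun j => π.symm j < π.symm k),
    fun l => ⨅ ψ : Decoder J X S n (W l), expDist p (d l) q ψ)

/-- The region `A_{1;π}^*`: the union over all test channels of the orthants
`A_{1;π}^*({q_k})` with apex `(R^π({q_k}), D^π({q_k}))`. -/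
def orthantRegion (J : ℕ) (p : (∀ k, X k) × S × V → ℝ) (d : ∀ l, V → W l → ℝ)
    (π : Equiv.Perm (Fin M)) : Set ((Fin M → ℝ) × (Fin L → ℝ)) :=
  {y | ∃ (n : Fin M → ℕ) (q : ∀ k : AuxIdx M J, X k → Fin (n k) → ℝ),
    IsTestChannel q ∧ (∀ i, (corner p d q π).1 i ≤ y.1 i) ∧ ∀ l, (corner p d q π).2 l ≤ y.2 l}

end

end CanonicalBound

/-!
For fixed test channels put `φ(A) = H(Z_A, S) - ∑_{i ∈ A} H(Z_i | X_i)` (`infoPotential`). Given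
`X_I`, the variables `Z_i`, `i ∈ I`, are independent of each other and of everything else, so
`I(X_I ; Z_I | Z_C, S) = φ(I ∪ C) - φ(C)` for disjoint `I`, `C` (`infoGiven_eq_sub`), and `φ` is
submodular by strong subadditivity of entropy (`infoPotential_insert_sub_le`). Both the rate
constraints and the corner points are expressed through `φ`.

The rate constraints `φ(univ) - φ(Iᶜ) ≤ R(I)` thus define a contrapolymatroid, and the rates of the
corner points are its greedy vertices. These satisfy the constraints (`sub_le_sum_greedyVertex`).
Conversely, a linear functional that is bounded below on the orthant has nonnegative coefficients,
and summation by parts shows that the greedy vertex for the order of the coefficients minimises it;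
a point outside the convex hull of the greedy vertices plus the orthant therefore violates a
constraint (`mem_convexHull_greedyVertex_add`). As minimal distortions are attained, the region of
fixed test channels is the convex hull of the orthants at its corner points
(`channelRegion_eq_convexHull`). The equality of convex hulls and the claim on the extreme points of
`A_1^*` follow, because an extreme point of the convex hull of a set belongs to the set.

For the alphabet sizes, an extreme point of `A_{1;π}^*` is a corner point, as otherwise it could be
moved both towards and away from the apex of its orthant. If `Z_k` has more values than `X_k`, the
columns of the channel matrix `q_k` satisfy a linear relation `∑_z q_k(z | x) c(z) = 0`, scaled to
`|c| ≤ 1` with the value `-1` attained. Replacing `q_k(z | x)` by `(1 ± c(z)) q_k(z | x)` gives test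
channels again, and the corner point is affine in this tilt: the nonlinear entropy terms cancel in
`φ`, and one decoder is optimal for all tilts (`corner_tilt_add_corner_tilt_neg`). By extremality
the corner point does not change, while the tilt by `c` removes a value of `Z_k`
(`exists_isRestriction`). So channels of least total alphabet size have the required sizes
(`exists_corner_eq_card_le`).
-/

namespace CanonicalBound

noncomputable section

/-! ### Entropy on a finite sample space -/

section Entropy

variable {Ω α β γ : Type*} [Fintype Ω] {P : Ω → ℝ}

theorem prob_nonneg (hP : ∀ ω, 0 ≤ P ω) (f : Ω → α) (a : α) : 0 ≤ prob P f a := by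
  classical
  exact Finset.sum_nonneg fun ω _ => by split_ifs <;> simp [hP]

theorem prob_apply_pos (hP : ∀ ω, 0 ≤ P ω) (f : Ω → α) {ω : Ω} (hω : P ω ≠ 0) :
    0 < prob P f (f ω) := by
  classical
  refine lt_of_lt_of_le (lt_of_le_of_ne (hP ω) hω.symm) ?_
  have := Finset.single_le_sum (f := fun ω' => if f ω' = f ω then P ω' else 0)
    (fun ω' _ => by split_ifs <;> simp [hP]) (Finset.mem_univ ω)
  simpa [prob] using this

theorem sum_prob_mul [Fintype α] (P : Ω → ℝ) (f : Ω → α) (G : α → ℝ) :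
    ∑ a, prob P f a * G a = ∑ ω, P ω * G (f ω) := by
  classical
  simp only [prob, Finset.sum_mul, ite_mul, zero_mul]
  rw [Finset.sum_comm]
  simp

/-- Entropy is the mean of the surprisal `-log P(f = f ω)`. In this form it depends only on the
partition of the sample space into the fibres of `f`. -/
theorem entropy_eq_neg_sum [Fintype α] (P : Ω → ℝ) (f : Ω → α) :
    entropy P f = -∑ ω, P ω * Real.log (prob P f (f ω)) := by
  rw [← sum_prob_mul P f fun a => Real.log (prob P f a)]
  simp [entropy, Real.negMulLog]

theorem prob_apply_congr {f : Ω → α} {g : Ω → β} (ω : Ω)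
    (h : ∀ ω', f ω' = f ω ↔ g ω' = g ω) : prob P f (f ω) = prob P g (g ω) := by
  classical
  simp [prob, h]

theorem entropy_congr [Fintype α] [Fintype β] {f : Ω → α} {g : Ω → β}
    (h : ∀ ω ω', f ω = f ω' ↔ g ω = g ω') : entropy P f = entropy P g := by
  rw [entropy_eq_neg_sum, entropy_eq_neg_sum]
  congr 1
  exact Finset.sum_congr rfl fun ω _ => by rw [prob_apply_congr ω fun ω' => h ω' ω]

theorem sum_prob_fst [Fintype α] (f : Ω → α) (h : Ω → γ) (c : γ) :
    ∑ a, prob P (fun ω => (f ω, h ω)) (a, c) = prob P h c := by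
  classical
  simp only [prob]
  rw [Finset.sum_comm]
  refine Finset.sum_congr rfl fun ω _ => ?_
  by_cases hc : h ω = c <;> simp [hc]

/-- Strong subadditivity of entropy, that is, `0 ≤ I(f ; g | h)`. -/
theorem entropy_add_entropy_le [Fintype α] [Fintype β] [Fintype γ] (hP : ∀ ω, 0 ≤ P ω)
    (f : Ω → α) (g : Ω → β) (h : Ω → γ) :
    entropy P (fun ω => (f ω, g ω, h ω)) + entropy P h ≤
      entropy P (fun ω => (f ω, h ω)) + entropy P (fun ω => (g ω, h ω)) := by
  set F : α → γ → ℝ := fun a c => prob P (fun ω => (f ω, h ω)) (a, c) with hF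
  set G : β → γ → ℝ := fun b c => prob P (fun ω => (g ω, h ω)) (b, c) with hG
  set T : α × β × γ → ℝ := fun x => prob P (fun ω => (f ω, g ω, h ω)) x with hT
  set H : γ → ℝ := fun c => prob P h c with hH
  have hF0 : ∀ a c, 0 ≤ F a c := fun a c => prob_nonneg hP _ _
  have hG0 : ∀ b c, 0 ≤ G b c := fun b c => prob_nonneg hP _ _
  have hH0 : ∀ c, 0 ≤ H c := fun c => prob_nonneg hP _ _
  have hT0 : ∀ x, 0 ≤ T x := fun x => prob_nonneg hP _ _
  -- the likelihood ratio of `P_{f|h} P_{g|h} P_h` against the joint law has mean at most one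
  have hratio : ∑ ω, P ω * (F (f ω) (h ω) * G (g ω) (h ω) / (T (f ω, g ω, h ω) * H (h ω)))
      ≤ ∑ ω, P ω := by
    have e1 := sum_prob_mul P (fun ω => (f ω, g ω, h ω))
      fun x => F x.1 x.2.2 * G x.2.1 x.2.2 / (T x * H x.2.2)
    have e2 := sum_prob_mul P h fun _ => 1
    simp only [mul_one] at e2
    rw [← e1, ← e2]
    calc ∑ x, T x * (F x.1 x.2.2 * G x.2.1 x.2.2 / (T x * H x.2.2))
        ≤ ∑ x : α × β × γ, F x.1 x.2.2 * G x.2.1 x.2.2 / H x.2.2 := by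
          refine Finset.sum_le_sum fun x _ => ?_
          rcases eq_or_ne (T x) 0 with h0 | h0
          · rw [h0, zero_mul]
            exact div_nonneg (mul_nonneg (hF0 _ _) (hG0 _ _)) (hH0 _)
          · rw [mul_div_mul_comm, ← mul_assoc]
            apply le_of_eq
            field_simp
      _ = ∑ c, (∑ a, F a c) * (∑ b, G b c) / H c := by
          simp only [Fintype.sum_prod_type, Finset.sum_mul_sum, Finset.sum_div]
          rw [Finset.sum_congr rfl fun a _ => Finset.sum_comm, Finset.sum_comm]
      _ = ∑ c, H c := by
          refine Finset.sum_congr rfl fun c _ => ?_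
          rw [show ∑ a, F a c = H c from sum_prob_fst f h c,
            show ∑ b, G b c = H c from sum_prob_fst g h c]
          exact mul_self_div_self _
  have hlog : ∀ ω, P ω * (Real.log (F (f ω) (h ω)) + Real.log (G (g ω) (h ω)) -
      Real.log (T (f ω, g ω, h ω)) - Real.log (H (h ω))) ≤
      P ω * (F (f ω) (h ω) * G (g ω) (h ω) / (T (f ω, g ω, h ω) * H (h ω))) - P ω := by
    intro ω
    rcases eq_or_ne (P ω) 0 with h0 | h0
    · simp [h0]
    have h1 : 0 < F (f ω) (h ω) := prob_apply_pos hP (fun ω => (f ω, h ω)) h0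
    have h2 : 0 < G (g ω) (h ω) := prob_apply_pos hP (fun ω => (g ω, h ω)) h0
    have h3 : 0 < T (f ω, g ω, h ω) := prob_apply_pos hP (fun ω => (f ω, g ω, h ω)) h0
    have h4 : 0 < H (h ω) := prob_apply_pos hP h h0
    have h5 := Real.log_le_sub_one_of_pos (div_pos (mul_pos h1 h2) (mul_pos h3 h4))
    rw [Real.log_div (by positivity) (by positivity), Real.log_mul h1.ne' h2.ne',
      Real.log_mul h3.ne' h4.ne'] at h5
    have h6 := mul_le_mul_of_nonneg_left h5 (hP ω)
    linarith
  have hsum := Finset.sum_le_sum fun ω (_ : ω ∈ Finset.univ) => hlog ω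
  simp only [Finset.sum_sub_distrib, mul_add, mul_sub, Finset.sum_add_distrib] at hsum
  simp only [entropy_eq_neg_sum]
  simp only [hF, hG, hT, hH] at hsum hratio
  linarith

end Entropy

/-! ### Test channels and conditional information -/

section Channels

variable {M L J : ℕ} {X : Fin M → Type*} {S V : Type*} {W : Fin L → Type*}
variable {n : Fin M → ℕ} {p : (∀ k, X k) × S × V → ℝ}
  {q : ∀ k : AuxIdx M J, X k → Fin (n k) → ℝ}

/-- The random variable `Z_k`, with `Z_k = X_k` for the first `J` indices. -/
def zVar (n : Fin M → ℕ) (k : Fin M) (ω : Outcome J X S V n) : X k ⊕ Fin (n k) :=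
  if h : J ≤ k.val then Sum.inr (ω.2 ⟨k, h⟩) else Sum.inl (ω.1.1 k)

/-- The likelihood `q_k(z_k | x_k)` of `Z_k` given `X_k`. For the first `J` indices, where
`Z_k = X_k`, it is `1`. -/
def channelLikelihood (q : ∀ k : AuxIdx M J, X k → Fin (n k) → ℝ) (k : Fin M)
    (ω : Outcome J X S V n) : ℝ :=
  if h : J ≤ k.val then q ⟨k, h⟩ (ω.1.1 k) (ω.2 ⟨k, h⟩) else 1

/-- The outcome `ω` with the value of `Z_k` replaced by `z`. -/
def resample (ω : Outcome J X S V n) (k : AuxIdx M J) (z : Fin (n k)) : Outcome J X S V n :=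
  (ω.1, Function.update ω.2 k z)

theorem zVar_aux (k : AuxIdx M J) (ω : Outcome J X S V n) :
    zVar n k ω = Sum.inr (ω.2 k) := by
  simp [zVar, k.2]

theorem zVar_resample (ω : Outcome J X S V n) (k : AuxIdx M J) (z : Fin (n k)) {j : Fin M}
    (hj : j ≠ k) : zVar n j (resample ω k z) = zVar n j ω := by
  unfold zVar resample
  split_ifs with h
  · exact congrArg Sum.inr
      (Function.update_of_ne (fun h' => hj (congrArg Subtype.val h')) _ _)
  · rfl

theorem zVec_eq_iff {I : Finset (Fin M)} {ω ω' : Outcome J X S V n} :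
    zVec n I ω = zVec n I ω' ↔ ∀ k ∈ I, zVar n k ω = zVar n k ω' := by
  rw [funext_iff]
  exact ⟨fun h k hk => h ⟨k, hk⟩, fun h k => h k.1 k.2⟩

theorem xVec_eq_iff {I : Finset (Fin M)} {ω ω' : Outcome J X S V n} :
    xVec n I ω = xVec n I ω' ↔ ∀ k ∈ I, ω.1.1 k = ω'.1.1 k := by
  rw [funext_iff]
  exact ⟨fun h k hk => h ⟨k, hk⟩, fun h k => h k.1 k.2⟩

theorem joint_nonneg (hp : ∀ x, 0 ≤ p x) (hq : IsTestChannel q) (ω : Outcome J X S V n) :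
    0 ≤ joint p q ω :=
  mul_nonneg (hp _) (Finset.prod_nonneg fun k _ => (hq k _).1 _)

theorem channelLikelihood_ne_zero {ω : Outcome J X S V n} (hω : joint p q ω ≠ 0) (k : Fin M) :
    channelLikelihood q k ω ≠ 0 := by
  unfold channelLikelihood
  split_ifs with h
  · exact Finset.prod_ne_zero_iff.1 (right_ne_zero_of_mul hω) ⟨k, h⟩ (Finset.mem_univ _)
  · exact one_ne_zero

theorem joint_resample_mul (ω : Outcome J X S V n) (k : AuxIdx M J) (z : Fin (n k)) :
    joint p q (resample ω k z) * q k (ω.1.1 k) (ω.2 k) =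
      joint p q ω * q k (ω.1.1 k) z := by
  classical
  unfold joint resample
  rw [← Finset.mul_prod_erase _ _ (Finset.mem_univ k),
    ← Finset.mul_prod_erase _ _ (Finset.mem_univ k)]
  have : ∏ j ∈ Finset.univ.erase k, q j (ω.1.1 j) (Function.update ω.2 k z j) =
      ∏ j ∈ Finset.univ.erase k, q j (ω.1.1 j) (ω.2 j) :=
    Finset.prod_congr rfl fun j hj => by rw [Function.update_of_ne (Finset.ne_of_mem_erase hj)]
  simp only [this, Function.update_self]
  ring

variable [∀ k, Fintype (X k)] [Fintype S] [Fintype V]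

/-- Drawing `Z_k` afresh from `q_k(· | x_k)` does not change expectations. -/
theorem sum_joint_resample (hq : IsTestChannel q) (k : AuxIdx M J)
    (F : Outcome J X S V n → ℝ) :
    ∑ ω, joint p q ω * ∑ z, q k (ω.1.1 k) z * F (resample ω k z) =
      ∑ ω, joint p q ω * F ω := by
  classical
  have hinv : Function.Involutive fun x : Outcome J X S V n × Fin (n k) =>
      (resample x.1 k x.2, x.1.2 k) := by
    rintro ⟨ω, z⟩
    simp [resample]
  calc ∑ ω, joint p q ω * ∑ z, q k (ω.1.1 k) z * F (resample ω k z)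
      = ∑ x : Outcome J X S V n × Fin (n k),
          joint p q x.1 * q k (x.1.1.1 k) x.2 * F (resample x.1 k x.2) := by
        simp only [Fintype.sum_prod_type, Finset.mul_sum, mul_assoc]
    _ = ∑ x : Outcome J X S V n × Fin (n k),
          joint p q x.1 * q k (x.1.1.1 k) x.2 * F x.1 := by
        rw [← Equiv.sum_comp hinv.toPerm fun x : Outcome J X S V n × Fin (n k) =>
          joint p q x.1 * q k (x.1.1.1 k) x.2 * F x.1]
        refine Finset.sum_congr rfl fun x _ => ?_
        change _ = joint p q (resample x.1 k x.2) * q k (x.1.1.1 k) (x.1.2 k) * _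
        rw [joint_resample_mul]
        rfl
    _ = ∑ ω, joint p q ω * F ω := by
        rw [Fintype.sum_prod_type]
        refine Finset.sum_congr rfl fun ω _ => ?_
        dsimp only
        rw [← Finset.sum_mul, ← Finset.mul_sum, (hq k _).2, mul_one]

/-- `Z_k` is conditionally independent given `X_k` of every `f` that does not involve `Z_k`. -/
theorem prob_pair_zVar {α : Type*} (hq : IsTestChannel q) (k : Fin M)
    {f : Outcome J X S V n → α} (hx : ∀ ω ω', f ω = f ω' → ω.1.1 k = ω'.1.1 k)
    (hf : ∀ (h : J ≤ k.val) ω z, f (resample ω ⟨k, h⟩ z) = f ω) (ω₀ : Outcome J X S V n) :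
    prob (joint p q) (fun ω => (f ω, zVar n k ω)) (f ω₀, zVar n k ω₀) =
      prob (joint p q) f (f ω₀) * channelLikelihood q k ω₀ := by
  classical
  by_cases h : J ≤ k.val
  · have hz : ∀ ω : Outcome J X S V n, zVar n k ω = Sum.inr (ω.2 ⟨k, h⟩) := fun ω =>
      zVar_aux ⟨k, h⟩ ω
    have := sum_joint_resample (p := p) hq ⟨k, h⟩
      fun ω => if f ω = f ω₀ ∧ ω.2 ⟨k, h⟩ = ω₀.2 ⟨k, h⟩ then 1 else 0
    simp only [prob, Prod.mk.injEq, hz, Sum.inr.injEq, channelLikelihood, h, dif_pos]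
    simp only [mul_ite, mul_one, mul_zero] at this
    rw [← this, Finset.sum_mul]
    refine Finset.sum_congr rfl fun ω _ => ?_
    simp only [hf]
    by_cases hω : f ω = f ω₀
    · simp [hω, resample, hx ω ω₀ hω]
    · simp [hω]
  · simp only [channelLikelihood, h, dif_neg, not_false_eq_true, mul_one]
    refine prob_apply_congr (f := fun ω => (f ω, zVar n k ω)) (g := f) ω₀ fun ω => ?_
    simp only [Prod.mk.injEq, and_iff_left_iff_imp]
    intro hω
    simp [zVar, h, hx ω ω₀ hω]

/-- The conditional entropy `H(Z_k | X_k)`, as the mean of `-log q_k(Z_k | X_k)`. -/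
def channelEntropy (p : (∀ k, X k) × S × V → ℝ) (q : ∀ k : AuxIdx M J, X k → Fin (n k) → ℝ)
    (k : Fin M) : ℝ :=
  -∑ ω, joint p q ω * Real.log (channelLikelihood q k ω)

/-- The entropy `H(Z_A, S)`. -/
def zEntropy (p : (∀ k, X k) × S × V → ℝ) (q : ∀ k : AuxIdx M J, X k → Fin (n k) → ℝ)
    (A : Finset (Fin M)) : ℝ :=
  entropy (joint p q) fun ω => (zVec n A ω, sVar n ω)

theorem entropy_pair_zVar {α : Type*} [Fintype α] (hp : ∀ x, 0 ≤ p x) (hq : IsTestChannel q)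
    (k : Fin M) {f : Outcome J X S V n → α} (hx : ∀ ω ω', f ω = f ω' → ω.1.1 k = ω'.1.1 k)
    (hf : ∀ (h : J ≤ k.val) ω z, f (resample ω ⟨k, h⟩ z) = f ω) :
    entropy (joint p q) (fun ω => (f ω, zVar n k ω)) =
      entropy (joint p q) f + channelEntropy p q k := by
  rw [entropy_eq_neg_sum, entropy_eq_neg_sum, channelEntropy, ← neg_add,
    ← Finset.sum_add_distrib]
  congr 1
  refine Finset.sum_congr rfl fun ω _ => ?_
  rcases eq_or_ne (joint p q ω) 0 with h0 | h0
  · simp [h0]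
  · rw [prob_pair_zVar hq k hx hf, Real.log_mul (prob_apply_pos (joint_nonneg hp hq) f h0).ne'
      (channelLikelihood_ne_zero h0 k), mul_add]

/-- Given `X_I`, the variables `Z_i`, `i ∈ I`, are independent of each other and of `Z_C`, `S`. -/
theorem entropy_xVec_zVec (hp : ∀ x, 0 ≤ p x) (hq : IsTestChannel q) {I C : Finset (Fin M)}
    (hIC : Disjoint I C) :
    entropy (joint p q) (fun ω => (xVec n I ω, zVec n I ω, zVec n C ω, sVar n ω)) =
      entropy (joint p q) (fun ω => (xVec n I ω, zVec n C ω, sVar n ω)) +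
        ∑ i ∈ I, channelEntropy p q i := by
  classical
  suffices h : ∀ K ⊆ I,
      entropy (joint p q) (fun ω => (xVec n I ω, zVec n K ω, zVec n C ω, sVar n ω)) =
      entropy (joint p q) (fun ω => (xVec n I ω, zVec n C ω, sVar n ω)) +
        ∑ i ∈ K, channelEntropy p q i from h I subset_rfl
  intro K
  induction K using Finset.induction_on with
  | empty =>
    intro _
    rw [Finset.sum_empty, add_zero]
    refine entropy_congr fun ω ω' => ?_
    simp only [Prod.mk.injEq, zVec_eq_iff]
    simp
  | insert k K hk ih =>
    intro hK
    have hkI : k ∈ I := hK (Finset.mem_insert_self k K)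
    have hkC : k ∉ C := Finset.disjoint_left.1 hIC hkI
    rw [Finset.sum_insert hk, add_left_comm, ← ih fun i hi => hK (Finset.mem_insert_of_mem hi),
      add_comm, ← entropy_pair_zVar hp hq k]
    · refine entropy_congr fun ω ω' => ?_
      simp only [Prod.mk.injEq, zVec_eq_iff, Finset.forall_mem_insert]
      tauto
    · intro ω ω' h
      simp only [Prod.mk.injEq, xVec_eq_iff] at h
      exact h.1 k hkI
    · intro h ω z
      simp only [Prod.mk.injEq, zVec_eq_iff]
      refine ⟨rfl, fun j hj => zVar_resample _ ⟨k, h⟩ _ ?_, fun j hj =>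
        zVar_resample _ ⟨k, h⟩ _ ?_, rfl⟩ <;> rintro rfl <;> contradiction

/-- `I(X_I ; Z_I | Z_C, S) = H(Z_I | Z_C, S) - ∑ H(Z_i | X_i)`. -/
theorem infoGiven_eq (hp : ∀ x, 0 ≤ p x) (hq : IsTestChannel q) {I C : Finset (Fin M)}
    (hIC : Disjoint I C) :
    infoGiven p q I C =
      zEntropy p q (I ∪ C) - zEntropy p q C - ∑ i ∈ I, channelEntropy p q i := by
  classical
  have h1 := entropy_xVec_zVec (p := p) hp hq hIC
  have h2 : entropy (joint p q) (fun ω => (zVec n I ω, zVec n C ω, sVar n ω)) =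
      zEntropy p q (I ∪ C) := by
    refine entropy_congr fun ω ω' => ?_
    simp only [Prod.mk.injEq, zVec_eq_iff, Finset.forall_mem_union]
    tauto
  simp only [infoGiven, condMutualInfo, condEntropy, h1, h2]
  unfold zEntropy
  ring

/-- Submodularity of `A ↦ H(Z_A, S)`: conditioning on more variables reduces entropy. -/
theorem zEntropy_insert_sub_le (hp : ∀ x, 0 ≤ p x) (hq : IsTestChannel q)
    {A B : Finset (Fin M)} (hAB : A ⊆ B) (k : Fin M) :
    zEntropy p q (insert k B) - zEntropy p q B ≤ zEntropy p q (insert k A) - zEntropy p q A := by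
  classical
  have h := entropy_add_entropy_le (joint_nonneg hp hq) (zVar n k) (zVec n B)
    fun ω => (zVec n A ω, sVar n ω)
  have hB : ∀ ω ω' : Outcome J X S V n, (∀ i ∈ B, zVar n i ω = zVar n i ω') →
      ∀ i ∈ A, zVar n i ω = zVar n i ω' := fun ω ω' h i hi => h i (hAB hi)
  have e1 : entropy (joint p q) (fun ω => (zVar n k ω, zVec n B ω, zVec n A ω, sVar n ω)) =
      zEntropy p q (insert k B) := by
    refine entropy_congr fun ω ω' => ?_
    have := hB ω ω'
    simp only [Prod.mk.injEq, zVec_eq_iff, Finset.forall_mem_insert]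
    tauto
  have e2 : entropy (joint p q) (fun ω => (zVec n B ω, zVec n A ω, sVar n ω)) =
      zEntropy p q B := by
    refine entropy_congr fun ω ω' => ?_
    have := hB ω ω'
    simp only [Prod.mk.injEq, zVec_eq_iff]
    tauto
  have e3 : entropy (joint p q) (fun ω => (zVar n k ω, zVec n A ω, sVar n ω)) =
      zEntropy p q (insert k A) := by
    refine entropy_congr fun ω ω' => ?_
    simp only [Prod.mk.injEq, zVec_eq_iff, Finset.forall_mem_insert]
    tauto
  rw [e1, e2, e3] at h
  change _ + zEntropy p q A ≤ _ at h
  linarith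

/-- The set function `A ↦ H(Z_A, S) - ∑_{i ∈ A} H(Z_i | X_i)`, whose increments are the
informations `I(X_I ; Z_I | Z_C, S)`. -/
def infoPotential (p : (∀ k, X k) × S × V → ℝ) (q : ∀ k : AuxIdx M J, X k → Fin (n k) → ℝ)
    (A : Finset (Fin M)) : ℝ :=
  zEntropy p q A - ∑ i ∈ A, channelEntropy p q i

theorem infoGiven_eq_sub (hp : ∀ x, 0 ≤ p x) (hq : IsTestChannel q) {I C : Finset (Fin M)}
    (hIC : Disjoint I C) :
    infoGiven p q I C = infoPotential p q (I ∪ C) - infoPotential p q C := by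
  rw [infoGiven_eq hp hq hIC, infoPotential, infoPotential, Finset.sum_union hIC]
  ring

theorem infoPotential_insert_sub_le (hp : ∀ x, 0 ≤ p x) (hq : IsTestChannel q)
    {A B : Finset (Fin M)} (hAB : A ⊆ B) {k : Fin M} (hk : k ∉ B) :
    infoPotential p q (insert k B) - infoPotential p q B ≤
      infoPotential p q (insert k A) - infoPotential p q A := by
  have := zEntropy_insert_sub_le hp hq hAB k
  simp only [infoPotential, Finset.sum_insert hk, Finset.sum_insert fun h => hk (hAB h)]
  linarith

/-- The vector of marginal values `h(prev_k ∪ {k}) - h(prev_k)`, with `prev_k` the set of elements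
that `π` lists before `k`: the vertex that the greedy algorithm finds in the polyhedron
`{R | ∀ I, h(univ) - h(Iᶜ) ≤ R(I)}`. -/
def greedyVertex (h : Finset (Fin M) → ℝ) (π : Equiv.Perm (Fin M)) (k : Fin M) : ℝ :=
  h (insert k (Finset.univ.filter fun j => π.symm j < π.symm k)) -
    h (Finset.univ.filter fun j => π.symm j < π.symm k)

theorem corner_fst (hp : ∀ x, 0 ≤ p x) (hq : IsTestChannel q) (d : ∀ l, V → W l → ℝ)
    (π : Equiv.Perm (Fin M)) : (corner p d q π).1 = greedyVertex (infoPotential p q) π := by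
  funext k
  change infoGiven p q {k} _ = _
  rw [infoGiven_eq_sub hp hq (by simp), ← Finset.insert_eq, greedyVertex]

end Channels

/-! ### The polyhedron of a submodular set function -/

section Polyhedron

open scoped Pointwise

variable {M : ℕ} {h : Finset (Fin M) → ℝ}

/-- The set of the first `m` elements in the list `π`. -/
def initialSegment (π : Equiv.Perm (Fin M)) (m : ℕ) : Finset (Fin M) :=
  Finset.univ.filter fun j => (π.symm j : ℕ) < m

theorem mem_initialSegment {π : Equiv.Perm (Fin M)} {m : ℕ} {j : Fin M} :
    j ∈ initialSegment π m ↔ (π.symm j : ℕ) < m := by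
  simp [initialSegment]

theorem initialSegment_succ (π : Equiv.Perm (Fin M)) (m : Fin M) :
    initialSegment π (m + 1) = insert (π m) (initialSegment π m) := by
  ext j
  rw [Finset.mem_insert, mem_initialSegment, mem_initialSegment, ← Equiv.symm_apply_eq,
    Nat.lt_succ_iff_lt_or_eq, Fin.ext_iff, or_comm]

theorem notMem_initialSegment (π : Equiv.Perm (Fin M)) (m : Fin M) :
    π m ∉ initialSegment π m := by
  simp [mem_initialSegment]

theorem initialSegment_zero (π : Equiv.Perm (Fin M)) : initialSegment π 0 = ∅ := by
  simp [initialSegment]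

theorem initialSegment_self (π : Equiv.Perm (Fin M)) : initialSegment π M = Finset.univ := by
  ext j
  simp [mem_initialSegment]

theorem greedyVertex_apply (h : Finset (Fin M) → ℝ) (π : Equiv.Perm (Fin M)) (m : Fin M) :
    greedyVertex h π (π m) = h (insert (π m) (initialSegment π m)) - h (initialSegment π m) := by
  simp only [greedyVertex, initialSegment, Equiv.symm_apply_apply, Fin.val_fin_lt]

theorem sum_greedyVertex_initialSegment (h : Finset (Fin M) → ℝ) (π : Equiv.Perm (Fin M))
    {m : ℕ} (hm : m ≤ M) :
    ∑ k ∈ initialSegment π m, greedyVertex h π k = h (initialSegment π m) - h ∅ := by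
  induction m with
  | zero => simp [initialSegment_zero]
  | succ m ih =>
    have hs := initialSegment_succ π ⟨m, hm⟩
    dsimp only at hs
    rw [hs, Finset.sum_insert (notMem_initialSegment π ⟨m, hm⟩), ih (by omega),
      greedyVertex_apply]
    ring

/-- The constraints indexed by the final segments of `π` are tight at the greedy vertex. -/
theorem sum_greedyVertex_compl (h : Finset (Fin M) → ℝ) (π : Equiv.Perm (Fin M))
    {m : ℕ} (hm : m ≤ M) :
    ∑ k ∈ (initialSegment π m)ᶜ, greedyVertex h π k =
      h Finset.univ - h (initialSegment π m) := by
  have h1 := sum_greedyVertex_initialSegment h π hm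
  have h2 := sum_greedyVertex_initialSegment h π le_rfl
  rw [initialSegment_self, ← Finset.sum_add_sum_compl (initialSegment π m), h1] at h2
  linarith

/-- The greedy vertex satisfies all constraints. -/
theorem sub_le_sum_greedyVertex
    (hsub : ∀ A B : Finset (Fin M), A ⊆ B → ∀ k ∉ B,
      h (insert k B) - h B ≤ h (insert k A) - h A)
    (π : Equiv.Perm (Fin M)) (I : Finset (Fin M)) :
    h Finset.univ - h Iᶜ ≤ ∑ k ∈ I, greedyVertex h π k := by
  suffices H : ∀ m ≤ M, h (Iᶜ ∪ initialSegment π m) - h Iᶜ ≤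
      ∑ k ∈ initialSegment π m ∩ I, greedyVertex h π k by
    simpa [initialSegment_self, Finset.union_eq_right.2 (Finset.subset_univ _)] using H M le_rfl
  intro m
  induction m with
  | zero => simp [initialSegment_zero]
  | succ m ih =>
    intro hm
    have hs := initialSegment_succ π ⟨m, hm⟩
    have hnot := notMem_initialSegment π ⟨m, hm⟩
    dsimp only at hs hnot
    have ih := ih (by omega)
    rw [hs, Finset.union_insert]
    by_cases hI : π ⟨m, hm⟩ ∈ I
    · rw [Finset.insert_inter_of_mem hI, Finset.sum_insert (by simp [hnot]), greedyVertex_apply]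
      have := hsub (initialSegment π m) (Iᶜ ∪ initialSegment π m) Finset.subset_union_right
        (π ⟨m, hm⟩) (by simp [hnot, hI])
      dsimp only at this ⊢
      linarith
    · rw [Finset.insert_inter_of_notMem hI, Finset.insert_eq_of_mem (by simp [hI])]
      exact ih

/-- Summation by parts. -/
theorem sum_mul_nonneg_of_monotone : ∀ {M : ℕ} {b v : Fin M → ℝ}, Monotone b → (∀ i, 0 ≤ b i) →
    (∀ m, 0 ≤ ∑ i, if m ≤ i then v i else 0) → 0 ≤ ∑ i, b i * v i
  | 0, _, _, _, _, _ => by simp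
  | M + 1, b, v, hb, hb0, hv => by
    have h1 := sum_mul_nonneg_of_monotone (b := fun i : Fin M => b i.succ - b 0)
      (v := fun i => v i.succ) (fun i j hij => sub_le_sub_right (hb (Fin.succ_le_succ_iff.2 hij)) _)
      (fun i => sub_nonneg.2 (hb (Fin.zero_le _)))
      (fun m => by
        have := hv m.succ
        rw [Fin.sum_univ_succ] at this
        simpa [Fin.succ_le_succ_iff] using this)
    have h2 := mul_nonneg (hb0 0) (hv 0)
    simp only [Fin.zero_le, if_true] at h2
    simp only [sub_mul, Finset.sum_sub_distrib, ← Finset.mul_sum] at h1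
    rw [Fin.sum_univ_succ] at h2 ⊢
    linarith

/-- The polyhedron `{R | ∀ I, h(univ) - h(Iᶜ) ≤ R(I)}` is contained in the convex hull of the greedy
vertices plus the nonnegative orthant. -/
theorem mem_convexHull_greedyVertex_add {R : Fin M → ℝ}
    (hR : ∀ I : Finset (Fin M), I.Nonempty → h Finset.univ - h Iᶜ ≤ ∑ i ∈ I, R i) :
    R ∈ convexHull ℝ (Set.range (greedyVertex h)) + Set.Ici 0 := by
  by_contra hnot
  have hcl : IsClosed (convexHull ℝ (Set.range (greedyVertex h)) + Set.Ici (0 : Fin M → ℝ)) :=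
    isClosed_Ici.add_left_of_isCompact ((Set.finite_range _).isCompact_convexHull ℝ)
  obtain ⟨f, u, hfR, hfC⟩ := geometric_hahn_banach_point_closed
    ((convex_convexHull ℝ _).add (convex_Ici 0)) hcl hnot
  have hmem : ∀ π, ∀ e : Fin M → ℝ, 0 ≤ e → u < f (greedyVertex h π) + f e := fun π e he => by
    rw [← map_add]
    exact hfC _ (Set.add_mem_add (subset_convexHull ℝ _ ⟨π, rfl⟩) he)
  set b : Fin M → ℝ := fun k => f (Pi.single k 1) with hb
  have hf : ∀ x : Fin M → ℝ, f x = ∑ k, b k * x k := fun x => by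
    conv_lhs => rw [← Finset.univ_sum_single x, map_sum]
    refine Finset.sum_congr rfl fun k _ => ?_
    rw [hb, mul_comm, ← smul_eq_mul, ← map_smul, ← Pi.single_smul, smul_eq_mul, mul_one]
  -- the separating functional is nonnegative, as it is bounded below on the orthant
  have hb0 : ∀ k, 0 ≤ b k := fun k => by
    by_contra! hk
    have h0 := hmem 1 0 le_rfl
    rw [map_zero, add_zero] at h0
    have h1 := hmem 1 (((f (greedyVertex h 1) - u) / -b k) • Pi.single k 1)
      (smul_nonneg (div_nonneg (by linarith) (by linarith)) (Pi.single_nonneg.2 zero_le_one))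
    rw [map_smul, smul_eq_mul] at h1
    change u < _ + _ / -b k * b k at h1
    rw [div_neg, neg_mul, div_mul_cancel₀ _ hk.ne] at h1
    linarith
  -- the order of the coefficients gives the greedy vertex that minimises the functional
  set π := Tuple.sort b with hπ
  have hmin : 0 ≤ ∑ i, b (π i) * (R (π i) - greedyVertex h π (π i)) := by
    refine sum_mul_nonneg_of_monotone (b := fun i => b (π i))
      (v := fun i => R (π i) - greedyVertex h π (π i)) (Tuple.monotone_sort b)
      (fun i => hb0 _) fun m => ?_
    have htail : ∑ i, (if m ≤ i then R (π i) - greedyVertex h π (π i) else 0) =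
        ∑ k ∈ (initialSegment π m)ᶜ, (R k - greedyVertex h π k) := by
      rw [← Finset.sum_filter]
      exact Finset.sum_equiv π (fun i => by simp [mem_initialSegment]) fun _ _ => rfl
    rw [htail, Finset.sum_sub_distrib, sum_greedyVertex_compl h π m.2.le]
    have := hR (initialSegment π m)ᶜ ⟨π m, by simp [mem_initialSegment]⟩
    rw [compl_compl] at this
    linarith
  rw [Equiv.sum_comp π fun k => b k * (R k - greedyVertex h π k)] at hmin
  have h1 := hmem π 0 le_rfl
  rw [map_zero, add_zero, hf] at h1
  rw [hf] at hfR
  simp only [mul_sub, Finset.sum_sub_distrib] at hmin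
  linarith

end Polyhedron

/-! ### Optimal decoders -/

section Decoders

variable {M L J : ℕ} {X : Fin M → Type*} {S V : Type*} {W : Fin L → Type*}
variable {n : Fin M → ℕ} {p : (∀ k, X k) × S × V → ℝ}
  {q : ∀ k : AuxIdx M J, X k → Fin (n k) → ℝ}

variable [Fintype V]

/-- `d` has a best reconstruction for every law on `V`. -/
def HasMinimizers {T : Type*} (d : V → T → ℝ) : Prop :=
  ∀ μ ∈ stdSimplex ℝ V, ∃ w : T, ∀ w' : T, ∑ v, μ v * d v w ≤ ∑ v, μ v * d v w'

theorem HasMinimizers.nonempty [Nonempty V] {T : Type*} {d : V → T → ℝ} (hd : HasMinimizers d) :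
    Nonempty T := by
  classical
  obtain ⟨v⟩ := ‹Nonempty V›
  exact ⟨(hd _ (single_mem_stdSimplex ℝ v)).choose⟩

theorem HasMinimizers.exists_of_nonneg [Nonempty V] {T : Type*} {d : V → T → ℝ}
    (hd : HasMinimizers d) {μ : V → ℝ} (hμ : ∀ v, 0 ≤ μ v) :
    ∃ w : T, ∀ w' : T, ∑ v, μ v * d v w ≤ ∑ v, μ v * d v w' := by
  rcases (Finset.sum_nonneg fun v (_ : v ∈ Finset.univ) => hμ v).eq_or_lt with h0 | h0
  · have hz : ∀ v, μ v = 0 := fun v =>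
      (Finset.sum_eq_zero_iff_of_nonneg fun v _ => hμ v).1 h0.symm v (Finset.mem_univ v)
    obtain ⟨w⟩ := hd.nonempty
    exact ⟨w, fun w' => by simp [hz]⟩
  · obtain ⟨w, hw⟩ := hd (fun v => μ v / ∑ v, μ v)
      ⟨fun v => div_nonneg (hμ v) h0.le, by rw [← Finset.sum_div, div_self h0.ne']⟩
    refine ⟨w, fun w' => ?_⟩
    have := hw w'
    simp only [div_mul_eq_mul_div, ← Finset.sum_div] at this
    exact (div_le_div_iff_of_pos_right h0).1 this

variable [∀ k, Fintype (X k)] [Fintype S]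

/-- A decoder that minimises the posterior expected distortion for each value of its inputs is
optimal for all reweightings of the joint distribution by a function of `Z_{J+1}, …, Z_M`. -/
theorem exists_decoder_forall_sum_le [Nonempty V] {T : Type*} {d : V → T → ℝ}
    (hd : HasMinimizers d) {P : Outcome J X S V n → ℝ} (hP : ∀ ω, 0 ≤ P ω) :
    ∃ ψ : Decoder J X S n T, ∀ g : (∀ k : AuxIdx M J, Fin (n k)) → ℝ, (∀ z, 0 ≤ g z) →
      ∀ ψ' : Decoder J X S n T,
        ∑ ω, P ω * g ω.2 * d ω.1.2.2 (ψ (fun k => ω.1.1 k) ω.2 ω.1.2.1) ≤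
          ∑ ω, P ω * g ω.2 * d ω.1.2.2 (ψ' (fun k => ω.1.1 k) ω.2 ω.1.2.1) := by
  classical
  set f : Outcome J X S V n →
      ((∀ k : DirectIdx M J, X k) × (∀ k : AuxIdx M J, Fin (n k)) × S) × V :=
    fun ω => ((fun k => ω.1.1 k, ω.2, ω.1.2.1), ω.1.2.2) with hf
  choose w hw using fun a => hd.exists_of_nonneg fun v => prob_nonneg hP f (a, v)
  refine ⟨fun x z s => w (x, z, s), fun g hg ψ' => ?_⟩
  have key : ∀ ψ : Decoder J X S n T,
      ∑ ω, P ω * g ω.2 * d ω.1.2.2 (ψ (fun k => ω.1.1 k) ω.2 ω.1.2.1) =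
        ∑ a : (∀ k : DirectIdx M J, X k) × (∀ k : AuxIdx M J, Fin (n k)) × S,
          g a.2.1 * ∑ v, prob P f (a, v) * d v (ψ a.1 a.2.1 a.2.2) := fun ψ => by
    have := sum_prob_mul P f fun b => g b.1.2.1 * d b.2 (ψ b.1.1 b.1.2.1 b.1.2.2)
    simp only [hf] at this ⊢
    simp only [mul_assoc]
    rw [← this, Fintype.sum_prod_type]
    simp only [Finset.mul_sum, mul_left_comm]
  refine (key fun x z s => w (x, z, s)).trans_le (le_trans ?_ (key ψ').ge)
  exact Finset.sum_le_sum fun a _ => mul_le_mul_of_nonneg_left (hw a _) (hg _)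

theorem exists_decoder_isLeast [Nonempty V] {T : Type*} {d : V → T → ℝ}
    (hd : HasMinimizers d) (hp : ∀ x, 0 ≤ p x) (hq : IsTestChannel q) :
    ∃ ψ : Decoder J X S n T, ∀ ψ', expDist p d q ψ ≤ expDist p d q ψ' := by
  obtain ⟨ψ, hψ⟩ := exists_decoder_forall_sum_le hd (joint_nonneg hp hq)
  refine ⟨ψ, fun ψ' => ?_⟩
  simpa [expDist] using hψ (fun _ => 1) (fun _ => zero_le_one) ψ'

theorem iInf_expDist_eq {T : Type*} {d : V → T → ℝ} {ψ : Decoder J X S n T}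
    (hψ : ∀ ψ', expDist p d q ψ ≤ expDist p d q ψ') :
    ⨅ ψ' : Decoder J X S n T, expDist p d q ψ' = expDist p d q ψ :=
  IsLeast.csInf_eq ⟨⟨ψ, rfl⟩, by rintro _ ⟨ψ', rfl⟩; exact hψ ψ'⟩

/-- Since the minimal distortion is attained, it may replace the choice of a decoder. -/
theorem exists_expDist_le_iff [Nonempty V] {T : Type*} {d : V → T → ℝ}
    (hd : HasMinimizers d) (hp : ∀ x, 0 ≤ p x) (hq : IsTestChannel q) (D : ℝ) :
    (∃ ψ : Decoder J X S n T, expDist p d q ψ ≤ D) ↔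
      ⨅ ψ : Decoder J X S n T, expDist p d q ψ ≤ D := by
  obtain ⟨ψ, hψ⟩ := exists_decoder_isLeast hd hp hq
  rw [iInf_expDist_eq hψ]
  exact ⟨fun ⟨ψ', h⟩ => (hψ ψ').trans h, fun h => ⟨ψ, h⟩⟩

end Decoders

/-! ### The region of fixed test channels -/

section Region

variable {M L J : ℕ} {X : Fin M → Type*} {S V : Type*} {W : Fin L → Type*}
variable {n : Fin M → ℕ} {p : (∀ k, X k) × S × V → ℝ}
  {q : ∀ k : AuxIdx M J, X k → Fin (n k) → ℝ} {d : ∀ l, V → W l → ℝ}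
variable [∀ k, Fintype (X k)] [Fintype S] [Fintype V] [Nonempty V]

theorem mem_channelRegion_iff (hp : ∀ x, 0 ≤ p x) (hq : IsTestChannel q)
    (hd : ∀ l, HasMinimizers (d l)) {y : (Fin M → ℝ) × (Fin L → ℝ)} :
    y ∈ channelRegion p d q ↔
      (∀ I : Finset (Fin M), I.Nonempty →
        infoPotential p q Finset.univ - infoPotential p q Iᶜ ≤ ∑ i ∈ I, y.1 i) ∧
      ∀ l, ⨅ ψ : Decoder J X S n (W l), expDist p (d l) q ψ ≤ y.2 l := by
  simp only [channelRegion, Set.mem_ofPred_eq, fun l => exists_expDist_le_iff (hd l) hp hq,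
    infoGiven_eq_sub hp hq disjoint_compl_right, Finset.union_compl]

theorem convex_channelRegion (hp : ∀ x, 0 ≤ p x) (hq : IsTestChannel q)
    (hd : ∀ l, HasMinimizers (d l)) : Convex ℝ (channelRegion p d q) := by
  intro x hx y hy a b ha hb hab
  rw [mem_channelRegion_iff hp hq hd] at hx hy ⊢
  have aux : ∀ {c u v : ℝ}, c ≤ u → c ≤ v → c ≤ a * u + b * v := fun {c u v} hu hv => by
    have h1 := mul_le_mul_of_nonneg_left hu ha
    have h2 := mul_le_mul_of_nonneg_left hv hb
    have h3 : a * c + b * c = c := by rw [← add_mul, hab, one_mul]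
    linarith
  refine ⟨fun I hI => ?_, fun l => aux (hx.2 l) (hy.2 l)⟩
  have := aux (hx.1 I hI) (hy.1 I hI)
  simpa [Finset.sum_add_distrib, Finset.mul_sum] using this

theorem Ici_corner_subset_channelRegion (hp : ∀ x, 0 ≤ p x) (hq : IsTestChannel q)
    (hd : ∀ l, HasMinimizers (d l)) (π : Equiv.Perm (Fin M)) :
    Set.Ici (corner p d q π) ⊆ channelRegion p d q := by
  intro y hy
  rw [mem_channelRegion_iff hp hq hd]
  refine ⟨fun I _ => ?_, hy.2⟩
  refine (sub_le_sum_greedyVertex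
    (fun A B hAB k hk => infoPotential_insert_sub_le hp hq hAB hk) π I).trans ?_
  rw [← corner_fst hp hq d π]
  exact Finset.sum_le_sum fun i _ => hy.1 i

/-- For fixed test channels, the region is the convex hull of the orthants at its corner points. -/
theorem channelRegion_eq_convexHull (hp : ∀ x, 0 ≤ p x) (hq : IsTestChannel q)
    (hd : ∀ l, HasMinimizers (d l)) :
    channelRegion p d q = convexHull ℝ (⋃ π, Set.Ici (corner p d q π)) := by
  refine subset_antisymm (fun y hy => ?_) (convexHull_min
    (Set.iUnion_subset fun π => Ici_corner_subset_channelRegion hp hq hd π)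
    (convex_channelRegion hp hq hd))
  rw [mem_channelRegion_iff hp hq hd] at hy
  obtain ⟨r, hr, e, he, hre⟩ := Set.mem_add.1 (mem_convexHull_greedyVertex_add hy.1)
  -- the same excess `e` over a convex combination of greedy vertices is put on each of them
  suffices h : convexHull ℝ (Set.range (greedyVertex (infoPotential p q))) ⊆
      {r | (r + e, y.2) ∈ convexHull ℝ (⋃ π, Set.Ici (corner p d q π))} by
    have := h hr
    rwa [Set.mem_ofPred_eq, hre] at this
  refine convexHull_min ?_ fun r hr r' hr' a b ha hb hab => ?_
  · rintro _ ⟨π, rfl⟩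
    refine subset_convexHull ℝ _ (Set.mem_iUnion.2 ⟨π, ?_, hy.2⟩)
    rw [corner_fst hp hq]
    exact le_add_of_nonneg_right he
  · have := convex_convexHull ℝ (⋃ π, Set.Ici (corner p d q π)) hr hr' ha hb hab
    have heq : (a • r + b • r' + e, y.2) = a • (r + e, y.2) + b • (r' + e, y.2) := by
      refine Prod.ext ?_ ?_
      · change _ = a • (r + e) + b • (r' + e)
        rw [smul_add, smul_add, add_add_add_comm, ← add_smul a b e, hab, one_smul]
      · change _ = a • y.2 + b • y.2
        rw [← add_smul, hab, one_smul]
    rwa [Set.mem_ofPred_eq, heq]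

theorem orthantRegion_subset_canonicalRegion (hp : ∀ x, 0 ≤ p x)
    (hd : ∀ l, HasMinimizers (d l)) (π : Equiv.Perm (Fin M)) :
    orthantRegion J p d π ⊆ canonicalRegion J p d := by
  rintro y ⟨n, q, hq, hy⟩
  exact ⟨n, q, hq, Ici_corner_subset_channelRegion hp hq hd π hy⟩

theorem convexHull_canonicalRegion (hp : ∀ x, 0 ≤ p x) (hd : ∀ l, HasMinimizers (d l)) :
    convexHull ℝ (canonicalRegion J p d) =
      convexHull ℝ (⋃ π : Equiv.Perm (Fin M), orthantRegion J p d π) := by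
  refine subset_antisymm (convexHull_min ?_ (convex_convexHull ℝ _)) (convexHull_mono
    (Set.iUnion_subset fun π => orthantRegion_subset_canonicalRegion hp hd π))
  rintro y ⟨n, q, hq, hy⟩
  rw [channelRegion_eq_convexHull hp hq hd] at hy
  have hsub : ∀ π, Set.Ici (corner p d q π) ⊆ orthantRegion J p d π :=
    fun π x hx => ⟨n, q, hq, hx⟩
  exact convexHull_mono (Set.iUnion_mono hsub) hy

theorem extremePoints_canonicalRegion_subset (hp : ∀ x, 0 ≤ p x)
    (hd : ∀ l, HasMinimizers (d l)) :
    Set.extremePoints ℝ (canonicalRegion J p d) ⊆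
      ⋃ π : Equiv.Perm (Fin M), Set.extremePoints ℝ (orthantRegion J p d π) := by
  intro y hy
  obtain ⟨n, q, hq, hyq⟩ := hy.1
  have hsub : channelRegion p d q ⊆ canonicalRegion J p d := fun x hx => ⟨n, q, hq, hx⟩
  have hext := inter_extremePoints_subset_extremePoints_of_subset hsub ⟨hyq, hy⟩
  rw [channelRegion_eq_convexHull hp hq hd] at hext
  obtain ⟨π, hπ⟩ := Set.mem_iUnion.1 (extremePoints_convexHull_subset hext)
  exact Set.mem_iUnion.2 ⟨π, inter_extremePoints_subset_extremePoints_of_subset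
    (orthantRegion_subset_canonicalRegion hp hd π) ⟨⟨n, q, hq, hπ⟩, hy⟩⟩

end Region

/-! ### Tilting a test channel -/

section Tilt

variable {M L J : ℕ} {X : Fin M → Type*} {S V : Type*} {W : Fin L → Type*}
variable {n : Fin M → ℕ} {p : (∀ k, X k) × S × V → ℝ}
  {q : ∀ k : AuxIdx M J, X k → Fin (n k) → ℝ} {k : AuxIdx M J} {c : Fin (n k) → ℝ}

/-- The test channels `q` with `q_k(z | x)` multiplied by `1 + c(z)`. -/
def tilt (q : ∀ k : AuxIdx M J, X k → Fin (n k) → ℝ) (k : AuxIdx M J) (c : Fin (n k) → ℝ) :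
    ∀ j : AuxIdx M J, X j → Fin (n j) → ℝ :=
  Function.update q k fun x z => (1 + c z) * q k x z

/-- Tilting by `c` gives test channels again. The second condition says that `c(Z_k)` has mean zero
given `X_k`. -/
structure IsTilt (q : ∀ k : AuxIdx M J, X k → Fin (n k) → ℝ) (k : AuxIdx M J)
    (c : Fin (n k) → ℝ) : Prop where
  nonneg : ∀ z, 0 ≤ 1 + c z
  mean_zero : ∀ x, ∑ z, q k x z * c z = 0

theorem IsTilt.isTestChannel (hq : IsTestChannel q) (hc : IsTilt q k c) :
    IsTestChannel (tilt q k c) := by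
  intro j x
  by_cases h : j = k
  · subst h
    rw [tilt, Function.update_self]
    refine ⟨fun z => mul_nonneg (hc.nonneg z) ((hq _ _).1 z), ?_⟩
    simp only [add_mul, one_mul, Finset.sum_add_distrib, (hq _ _).2, mul_comm (c _),
      hc.mean_zero, add_zero]
  · rw [tilt, Function.update_of_ne h]
    exact hq j x

theorem joint_tilt (ω : Outcome J X S V n) :
    joint p (tilt q k c) ω = joint p q ω * (1 + c (ω.2 k)) := by
  unfold joint
  rw [← Finset.mul_prod_erase _ _ (Finset.mem_univ k),
    ← Finset.mul_prod_erase _ _ (Finset.mem_univ k)]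
  have : ∏ j ∈ Finset.univ.erase k, tilt q k c j (ω.1.1 j) (ω.2 j) =
      ∏ j ∈ Finset.univ.erase k, q j (ω.1.1 j) (ω.2 j) :=
    Finset.prod_congr rfl fun j hj => by
      rw [tilt, Function.update_of_ne (Finset.ne_of_mem_erase hj)]
  rw [this, tilt, Function.update_self]
  ring

theorem channelLikelihood_tilt (i : Fin M) (ω : Outcome J X S V n) :
    channelLikelihood (tilt q k c) i ω =
      channelLikelihood q i ω * if i = k then 1 + c (ω.2 k) else 1 := by
  unfold channelLikelihood
  by_cases h : i = k
  · subst h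
    rw [dif_pos k.2, dif_pos k.2, if_pos rfl]
    change tilt q k c k _ _ = q k _ _ * _
    rw [tilt, Function.update_self, mul_comm]
  · have : ∀ hi : J ≤ i.val, (⟨i, hi⟩ : AuxIdx M J) ≠ k := fun hi h' => h (congrArg Subtype.val h')
    simp [h, tilt, this]

variable [∀ k, Fintype (X k)] [Fintype S] [Fintype V]

/-- Tilting multiplies the probabilities of the values of `(Z_A, S)` by `1 + c(Z_k)` if `k ∈ A`. If
`k ∉ A`, it does not change them, since `c(Z_k)` has mean zero given all the other variables. -/
theorem prob_tilt (hq : IsTestChannel q) (hc : IsTilt q k c) (A : Finset (Fin M))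
    (ω₀ : Outcome J X S V n) :
    prob (joint p (tilt q k c)) (fun ω => (zVec n A ω, sVar n ω)) (zVec n A ω₀, sVar n ω₀) =
      prob (joint p q) (fun ω => (zVec n A ω, sVar n ω)) (zVec n A ω₀, sVar n ω₀) *
        if k.1 ∈ A then 1 + c (ω₀.2 k) else 1 := by
  classical
  simp only [prob, joint_tilt]
  split_ifs with hk
  · rw [Finset.sum_mul]
    refine Finset.sum_congr rfl fun ω _ => ?_
    split_ifs with h
    · have h1 := zVec_eq_iff.1 (Prod.mk.inj h).1 _ hk
      rw [zVar_aux, zVar_aux, Sum.inr.injEq] at h1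
      rw [h1]
    · simp
  · have h1 := sum_joint_resample (p := p) hq k fun ω =>
      (1 + c (ω.2 k)) * if (zVec n A ω, sVar n ω) = (zVec n A ω₀, sVar n ω₀) then 1 else 0
    have h2 : ∀ (ω : Outcome J X S V n) z,
        (zVec n A (resample ω k z), sVar n (resample ω k z)) = (zVec n A ω, sVar n ω) :=
      fun ω z => Prod.ext (zVec_eq_iff.2 fun j hj => zVar_resample ω k z
        fun h => hk (h ▸ hj)) rfl
    have h3 : ∀ ω : Outcome J X S V n,
        ∑ z, q k (ω.1.1 k) z * (1 + c ((resample ω k z).2 k)) = 1 := fun ω => by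
      simp [resample, mul_add, Finset.sum_add_distrib, (hq _ _).2, hc.mean_zero]
    simp only [h2, ← mul_assoc, ← Finset.sum_mul, h3, one_mul] at h1
    simp only [mul_ite, mul_one, mul_zero] at h1
    rw [mul_one]
    convert h1.symm

/-- The nonlinear term of the entropies under tilting by `c`. It occurs in `H(Z_A, S)` exactly if
`k ∈ A`, and in `H(Z_i | X_i)` exactly if `i = k`. -/
def tiltEntropy (p : (∀ k, X k) × S × V → ℝ) (q : ∀ k : AuxIdx M J, X k → Fin (n k) → ℝ)
    (k : AuxIdx M J) (c : Fin (n k) → ℝ) : ℝ :=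
  ∑ ω, joint p q ω * (1 + c (ω.2 k)) * Real.log (1 + c (ω.2 k))

theorem zEntropy_tilt (hp : ∀ x, 0 ≤ p x) (hq : IsTestChannel q) (hc : IsTilt q k c)
    (A : Finset (Fin M)) :
    zEntropy p (tilt q k c) A = zEntropy p q A -
      ∑ ω, joint p q ω * c (ω.2 k) * Real.log (prob (joint p q)
        (fun ω => (zVec n A ω, sVar n ω)) (zVec n A ω, sVar n ω)) -
      if k.1 ∈ A then tiltEntropy p q k c else 0 := by
  have key : ∀ ω, joint p (tilt q k c) ω * Real.log (prob (joint p (tilt q k c))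
        (fun ω => (zVec n A ω, sVar n ω)) (zVec n A ω, sVar n ω)) =
      joint p q ω * Real.log (prob (joint p q)
        (fun ω => (zVec n A ω, sVar n ω)) (zVec n A ω, sVar n ω)) +
      joint p q ω * c (ω.2 k) * Real.log (prob (joint p q)
        (fun ω => (zVec n A ω, sVar n ω)) (zVec n A ω, sVar n ω)) +
      if k.1 ∈ A then joint p q ω * (1 + c (ω.2 k)) * Real.log (1 + c (ω.2 k)) else 0 := by
    intro ω
    rw [joint_tilt, prob_tilt hq hc]
    rcases eq_or_ne (joint p q ω) 0 with h0 | h0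
    · simp [h0]
    rcases eq_or_ne (1 + c (ω.2 k)) 0 with h1 | h1
    · simp [eq_neg_of_add_eq_zero_right h1]
    rw [Real.log_mul (prob_apply_pos (joint_nonneg hp hq)
      (fun ω => (zVec n A ω, sVar n ω)) h0).ne' (by split_ifs <;> simp [h1])]
    split_ifs
    · ring
    · rw [Real.log_one]
      ring
  simp only [zEntropy, entropy_eq_neg_sum, key, Finset.sum_add_distrib, tiltEntropy]
  split_ifs
  · ring
  · simp
    ring

theorem channelEntropy_tilt (c : Fin (n k) → ℝ) (i : Fin M) :
    channelEntropy p (tilt q k c) i = channelEntropy p q i -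
      ∑ ω, joint p q ω * c (ω.2 k) * Real.log (channelLikelihood q i ω) -
      if i = k then tiltEntropy p q k c else 0 := by
  have key : ∀ ω, joint p (tilt q k c) ω * Real.log (channelLikelihood (tilt q k c) i ω) =
      joint p q ω * Real.log (channelLikelihood q i ω) +
      joint p q ω * c (ω.2 k) * Real.log (channelLikelihood q i ω) +
      if i = k then joint p q ω * (1 + c (ω.2 k)) * Real.log (1 + c (ω.2 k)) else 0 := by
    intro ω
    rw [joint_tilt, channelLikelihood_tilt]
    rcases eq_or_ne (joint p q ω) 0 with h0 | h0
    · simp [h0]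
    rcases eq_or_ne (1 + c (ω.2 k)) 0 with h1 | h1
    · simp [eq_neg_of_add_eq_zero_right h1]
    rw [Real.log_mul (channelLikelihood_ne_zero h0 i) (by split_ifs <;> simp [h1])]
    split_ifs
    · ring
    · rw [Real.log_one]
      ring
  simp only [channelEntropy, key, Finset.sum_add_distrib, tiltEntropy]
  split_ifs
  · ring
  · simp
    ring

/-- The potential, and hence every rate of a corner point, is affine in the tilt. -/
theorem exists_infoPotential_tilt (hp : ∀ x, 0 ≤ p x) (hq : IsTestChannel q) (k : AuxIdx M J)
    (A : Finset (Fin M)) :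
    ∃ G : Outcome J X S V n → ℝ, ∀ c : Fin (n k) → ℝ, IsTilt q k c →
      infoPotential p (tilt q k c) A =
        infoPotential p q A + ∑ ω, joint p q ω * c (ω.2 k) * G ω := by
  refine ⟨fun ω => ∑ i ∈ A, Real.log (channelLikelihood q i ω) -
    Real.log (prob (joint p q) (fun ω => (zVec n A ω, sVar n ω)) (zVec n A ω, sVar n ω)),
    fun c hc => ?_⟩
  simp only [infoPotential, zEntropy_tilt hp hq hc, channelEntropy_tilt, mul_sub,
    Finset.sum_sub_distrib, Finset.mul_sum, Finset.sum_ite_eq']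
  rw [Finset.sum_comm (s := A)]
  ring

/-- The corner points of two opposite tilts have the original corner point as their midpoint. -/
theorem corner_tilt_add_corner_tilt_neg [Nonempty V] {d : ∀ l, V → W l → ℝ}
    (hp : ∀ x, 0 ≤ p x) (hq : IsTestChannel q) (hd : ∀ l, HasMinimizers (d l))
    (hc : IsTilt q k c) (hc' : IsTilt q k (-c)) (π : Equiv.Perm (Fin M)) :
    corner p d (tilt q k c) π + corner p d (tilt q k (-c)) π =
      corner p d q π + corner p d q π := by
  refine Prod.ext ?_ (funext fun l => ?_)
  · have hpot : ∀ A, infoPotential p (tilt q k c) A + infoPotential p (tilt q k (-c)) A =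
        infoPotential p q A + infoPotential p q A := fun A => by
      obtain ⟨G, hG⟩ := exists_infoPotential_tilt (S := S) (V := V) hp hq k A
      rw [hG c hc, hG _ hc']
      simp only [Pi.neg_apply, mul_neg, neg_mul, Finset.sum_neg_distrib]
      ring
    funext i
    simp only [Prod.fst_add, corner_fst hp hq, corner_fst hp (hc.isTestChannel hq),
      corner_fst hp (hc'.isTestChannel hq), Pi.add_apply, greedyVertex]
    linarith [hpot (insert i (Finset.univ.filter fun j => π.symm j < π.symm i)),
      hpot (Finset.univ.filter fun j => π.symm j < π.symm i)]
  · -- one decoder is optimal for the channels and for both tilts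
    obtain ⟨ψ, hψ⟩ := exists_decoder_forall_sum_le (hd l) (joint_nonneg hp hq)
    have h0 : ∀ ψ', expDist p (d l) q ψ ≤ expDist p (d l) q ψ' := fun ψ' => by
      simpa [expDist] using hψ (fun _ => 1) (fun _ => zero_le_one) ψ'
    have h1 : ∀ c', IsTilt q k c' → ∀ ψ',
        expDist p (d l) (tilt q k c') ψ ≤ expDist p (d l) (tilt q k c') ψ' := fun c' hc' ψ' => by
      simpa only [expDist, joint_tilt] using
        hψ (fun z => 1 + c' (z k)) (fun z => hc'.nonneg _) ψ'
    change (⨅ ψ', expDist p (d l) _ ψ') + (⨅ ψ', expDist p (d l) _ ψ') =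
      (⨅ ψ', expDist p (d l) _ ψ') + (⨅ ψ', expDist p (d l) _ ψ')
    rw [iInf_expDist_eq h0, iInf_expDist_eq (h1 c hc), iInf_expDist_eq (h1 _ hc')]
    simp only [expDist, joint_tilt, ← Finset.sum_add_distrib, Pi.neg_apply]
    exact Finset.sum_congr rfl fun ω _ => by ring

/-- If `Z_k` has more values than `X_k`, the channel can be tilted in both directions, one of which
removes a value of `Z_k`. -/
theorem exists_isTilt
    (hcard : Fintype.card (X k) < n k) :
    ∃ c : Fin (n k) → ℝ, IsTilt q k c ∧ IsTilt q k (-c) ∧ ∃ z, 1 + c z = 0 := by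
  -- a linear relation among the columns of the channel matrix
  obtain ⟨c, hc, hc0⟩ := Submodule.exists_mem_ne_zero_of_ne_bot
    (LinearMap.ker_ne_bot_of_finrank_lt (f := (Matrix.of (q k)).mulVecLin) (by simpa using hcard))
  have hrel : ∀ x, ∑ z, q k x z * c z = 0 := fun x => congrFun (LinearMap.mem_ker.1 hc) x
  obtain ⟨z₁, hz₁⟩ := Function.ne_iff.1 hc0
  obtain ⟨z₀, -, hz₀⟩ :=
    Finset.exists_max_image Finset.univ (fun z => |c z|) ⟨z₁, Finset.mem_univ _⟩
  have hpos : c z₀ ≠ 0 := abs_pos.1 ((abs_pos.2 hz₁).trans_le (hz₀ z₁ (Finset.mem_univ _)))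
  -- normalised so that the entry of largest absolute value is `-1`
  have habs : ∀ z, |c z / c z₀| ≤ 1 := fun z => by
    rw [abs_div, div_le_one (abs_pos.2 hpos)]
    exact hz₀ z (Finset.mem_univ _)
  have hzero : ∀ x, ∑ z, q k x z * (c z / c z₀) = 0 := fun x => by
    simp only [← mul_div_assoc, ← Finset.sum_div, hrel, zero_div]
  refine ⟨fun z => -(c z / c z₀), ⟨fun z => ?_, fun x => ?_⟩, ⟨fun z => ?_, fun x => ?_⟩, z₀, ?_⟩
  · linarith [(abs_le.1 (habs z)).2]
  · simp [hzero]
  · simp only [Pi.neg_apply, neg_neg]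
    linarith [(abs_le.1 (habs z)).1]
  · simp [hzero]
  · simp [hpos]

end Tilt

/-! ### Removing unused values of the auxiliary variables -/

section Restriction

variable {M L J : ℕ} {X : Fin M → Type*} {S V : Type*} {W : Fin L → Type*}
variable {n n' : Fin M → ℕ} {p : (∀ k, X k) × S × V → ℝ}
  {q : ∀ k : AuxIdx M J, X k → Fin (n k) → ℝ} {q' : ∀ k : AuxIdx M J, X k → Fin (n' k) → ℝ}
  {e : ∀ k : AuxIdx M J, Fin (n' k) → Fin (n k)}

/-- Entropy does not change when the sample space is restricted to a set that carries `P`. -/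
theorem entropy_comp_of_injective {Ω Ω' α α' : Type*} [Fintype Ω] [Fintype Ω'] [Fintype α]
    [Fintype α'] {P : Ω → ℝ} {P' : Ω' → ℝ} {E : Ω' → Ω} (hE : Function.Injective E)
    (hP : ∀ ω ∉ Set.range E, P ω = 0) (hP' : ∀ ω, P' ω = P (E ω)) {f : Ω → α} {f' : Ω' → α'}
    (hf : ∀ a b, f' a = f' b ↔ f (E a) = f (E b)) : entropy P' f' = entropy P f := by
  classical
  rw [entropy_eq_neg_sum, entropy_eq_neg_sum]
  congr 1
  refine Fintype.sum_of_injective E hE _ _ (fun ω hω => by simp [hP ω hω]) fun a => ?_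
  rw [hP']
  congr 2
  refine Fintype.sum_of_injective E hE _ _ (fun ω hω => by simp [hP ω hω]) fun b => ?_
  simp only [hf, hP']

/-- The test channels `q'` are the test channels `q` with the alphabets embedded by `e` into those
of `q`, which have no other values of positive probability. -/
structure IsRestriction (q : ∀ k : AuxIdx M J, X k → Fin (n k) → ℝ)
    (q' : ∀ k : AuxIdx M J, X k → Fin (n' k) → ℝ)
    (e : ∀ k : AuxIdx M J, Fin (n' k) → Fin (n k)) : Prop where
  injective : ∀ k, Function.Injective (e k)
  apply_eq : ∀ k x z, q' k x z = q k x (e k z)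
  eq_zero : ∀ k x, ∀ z ∉ Set.range (e k), q k x z = 0

theorem IsRestriction.isTestChannel (h : IsRestriction q q' e) (hq : IsTestChannel q) :
    IsTestChannel q' := by
  refine fun k x => ⟨fun z => ?_, ?_⟩
  · rw [h.apply_eq]
    exact (hq k x).1 _
  · rw [← (hq k x).2]
    exact Fintype.sum_of_injective (e k) (h.injective k) _ _ (h.eq_zero k x) (h.apply_eq k x)

/-- The embedding of the sample space induced by embeddings of the alphabets. -/
def embedOutcome (e : ∀ k : AuxIdx M J, Fin (n' k) → Fin (n k)) (ω : Outcome J X S V n') :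
    Outcome J X S V n :=
  (ω.1, fun k => e k (ω.2 k))

theorem embedOutcome_injective (he : ∀ k, Function.Injective (e k)) :
    Function.Injective (embedOutcome (X := X) (S := S) (V := V) e) := fun _ _ hab =>
  Prod.ext (congrArg (fun ω => ω.1) hab)
    (funext fun k => he k (congrFun (congrArg (fun ω => ω.2) hab) k))

theorem IsRestriction.joint_eq (h : IsRestriction q q' e) (ω : Outcome J X S V n') :
    joint p q' ω = joint p q (embedOutcome e ω) := by
  simp only [joint, embedOutcome, h.apply_eq]

theorem IsRestriction.joint_eq_zero (h : IsRestriction q q' e) {ω : Outcome J X S V n}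
    (hω : ω ∉ Set.range (embedOutcome e)) : joint p q ω = 0 := by
  by_contra h0
  have hk : ∀ k, ∃ z, e k z = ω.2 k := fun k => by
    by_contra hk
    exact Finset.prod_ne_zero_iff.1 (right_ne_zero_of_mul h0) k (Finset.mem_univ k)
      (h.eq_zero k _ _ hk)
  choose z hz using hk
  exact hω ⟨(ω.1, z), Prod.ext rfl (funext hz)⟩

theorem zVar_embedOutcome (he : ∀ k, Function.Injective (e k)) {a b : Outcome J X S V n'}
    {k : Fin M} : zVar n' k a = zVar n' k b ↔
      zVar n k (embedOutcome e a) = zVar n k (embedOutcome e b) := by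
  unfold zVar
  split_ifs with h
  · simp [embedOutcome, (he ⟨k, h⟩).eq_iff]
  · simp [embedOutcome]

variable [∀ k, Fintype (X k)] [Fintype S] [Fintype V]

theorem IsRestriction.infoGiven_eq (h : IsRestriction q q' e) (I C : Finset (Fin M)) :
    infoGiven p q' I C = infoGiven p q I C := by
  have hE := embedOutcome_injective (X := X) (S := S) (V := V) h.injective
  have key : ∀ {α α' : Type _} [Fintype α] [Fintype α'] {f : Outcome J X S V n → α}
      {f' : Outcome J X S V n' → α'},
      (∀ a b, f' a = f' b ↔ f (embedOutcome e a) = f (embedOutcome e b)) →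
      entropy (joint p q') f' = entropy (joint p q) f := fun hf =>
    entropy_comp_of_injective hE (fun ω hω => h.joint_eq_zero hω) (fun ω => h.joint_eq ω) hf
  have hx : ∀ a b : Outcome J X S V n', xVec n' I a = xVec n' I b ↔
      xVec n I (embedOutcome e a) = xVec n I (embedOutcome e b) := fun _ _ => Iff.rfl
  have hs : ∀ a b : Outcome J X S V n', sVar n' a = sVar n' b ↔
      sVar n (embedOutcome e a) = sVar n (embedOutcome e b) := fun _ _ => Iff.rfl
  have hz : ∀ (A : Finset (Fin M)) (a b : Outcome J X S V n'), zVec n' A a = zVec n' A b ↔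
      zVec n A (embedOutcome e a) = zVec n A (embedOutcome e b) := fun A a b => by
    simp only [zVec_eq_iff, zVar_embedOutcome h.injective]
  unfold infoGiven condMutualInfo condEntropy
  congr 2 <;> refine key fun a b => ?_ <;> simp only [Prod.mk.injEq, ← hx, ← hs, ← hz]

theorem IsRestriction.iInf_expDist_eq (h : IsRestriction q q' e) {T : Type*} [Nonempty T]
    (d : V → T → ℝ) :
    ⨅ ψ : Decoder J X S n' T, expDist p d q' ψ = ⨅ ψ : Decoder J X S n T, expDist p d q ψ := by
  refine (Function.Surjective.iInf_congr
    (fun (ψ : Decoder J X S n T) x z s => ψ x (fun k => e k (z k)) s) (fun ψ' => ?_)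
    fun ψ => ?_).symm
  · have he : Function.Injective fun (z : ∀ k, Fin (n' k.1)) (k : AuxIdx M J) => e k (z k) :=
      fun z z' hz => funext fun k => h.injective k (congrFun hz k)
    refine ⟨fun x z s => Function.extend (fun (z : ∀ k, Fin (n' k.1)) k => e k (z k))
      (fun z => ψ' x z s) (fun _ => Classical.arbitrary T) z, ?_⟩
    funext x z s
    exact he.extend_apply _ _ z
  · refine Fintype.sum_of_injective (embedOutcome e) (embedOutcome_injective h.injective) _ _
      (fun ω hω => by rw [h.joint_eq_zero hω, zero_mul]) fun ω => ?_
    rw [h.joint_eq]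
    rfl

theorem IsRestriction.corner_eq (h : IsRestriction q q' e) [∀ l, Nonempty (W l)]
    (d : ∀ l, V → W l → ℝ) (π : Equiv.Perm (Fin M)) : corner p d q' π = corner p d q π :=
  Prod.ext (funext fun _ => h.infoGiven_eq _ _) (funext fun l => h.iInf_expDist_eq (d l))

omit [∀ k, Fintype (X k)] in
/-- A value that a channel never takes can be removed from its alphabet. -/
theorem exists_isRestriction {k : AuxIdx M J} {z₀ : Fin (n k)} (hz₀ : ∀ x, q k x z₀ = 0) :
    ∃ (n' : Fin M → ℕ) (q' : ∀ k : AuxIdx M J, X k → Fin (n' k) → ℝ)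
      (e : ∀ k : AuxIdx M J, Fin (n' k) → Fin (n k)),
      IsRestriction q q' e ∧ ∑ j : AuxIdx M J, n' j < ∑ j : AuxIdx M J, n j := by
  -- the alphabets of `q'` enumerate the supports of the channels `q`
  let supp : ∀ j : Fin M, Fin (n j) → Prop := fun j z => ∃ h x, q ⟨j, h⟩ x z ≠ 0
  let n' : Fin M → ℕ := fun j => Nat.card {z // supp j z}
  let e : ∀ j : AuxIdx M J, Fin (n' j) → Fin (n j) := fun j z =>
    ((Finite.equivFin {z // supp j z}).symm z).1
  refine ⟨n', fun j x z => q j x (e j z), e,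
    ⟨fun j => ?_, fun _ _ _ => rfl, fun j x z hz => ?_⟩, ?_⟩
  · exact Subtype.val_injective.comp (Equiv.injective _)
  · by_contra h0
    exact hz ⟨Finite.equivFin _ ⟨z, j.2, x, h0⟩, by simp [e]⟩
  · refine Finset.sum_lt_sum (fun j _ => ?_) ⟨k, Finset.mem_univ k, ?_⟩
    · simpa using Finite.card_subtype_le (supp j)
    · have : ¬ supp k z₀ := by
        rintro ⟨_, x, hx⟩
        exact hx (hz₀ x)
      simpa using Finite.card_subtype_lt this

end Restriction

/-! ### Extreme points of the orthant regions -/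

section ExtremePoints

variable {M L J : ℕ} {X : Fin M → Type*} {S V : Type*} {W : Fin L → Type*}
variable {p : (∀ k, X k) × S × V → ℝ} {d : ∀ l, V → W l → ℝ} {π : Equiv.Perm (Fin M)}
variable [∀ k, Fintype (X k)] [Fintype S] [Fintype V]

theorem eq_of_mem_extremePoints_of_add_eq {E : Type*} [AddCommGroup E] [Module ℝ E] {A : Set E}
    {y a b : E} (hy : y ∈ Set.extremePoints ℝ A) (ha : a ∈ A) (hb : b ∈ A) (hab : a + b = y + y) :
    a = y := by
  refine hy.2 ha hb ⟨1 / 2, 1 / 2, by norm_num, by norm_num, by norm_num, ?_⟩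
  rw [← smul_add, hab, ← two_smul ℝ y, smul_smul]
  norm_num

/-- A point of the orthant other than its apex is the midpoint of the apex and the reflected apex,
which lies in the orthant too. -/
theorem exists_eq_corner_of_mem_extremePoints {y : (Fin M → ℝ) × (Fin L → ℝ)}
    (hy : y ∈ Set.extremePoints ℝ (orthantRegion J p d π)) :
    ∃ (n : Fin M → ℕ) (q : ∀ k : AuxIdx M J, X k → Fin (n k) → ℝ),
      IsTestChannel q ∧ y = corner p d q π := by
  obtain ⟨n, q, hq, hle⟩ := hy.1
  have hle : corner p d q π ≤ y := hle
  refine ⟨n, q, hq, (eq_of_mem_extremePoints_of_add_eq (b := y + (y - corner p d q π)) hy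
    ⟨n, q, hq, fun _ => le_rfl, fun _ => le_rfl⟩ ?_ (by abel)).symm⟩
  have : corner p d q π ≤ y + (y - corner p d q π) :=
    hle.trans (le_add_of_nonneg_right (sub_nonneg.2 hle))
  exact ⟨n, q, hq, this⟩

theorem exists_corner_eq_card_le [Nonempty V] (hp : ∀ x, 0 ≤ p x)
    (hd : ∀ l, HasMinimizers (d l)) {y : (Fin M → ℝ) × (Fin L → ℝ)}
    (hy : y ∈ Set.extremePoints ℝ (orthantRegion J p d π)) :
    ∃ (n : Fin M → ℕ) (q : ∀ k : AuxIdx M J, X k → Fin (n k) → ℝ),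
      IsTestChannel q ∧ (∀ k : AuxIdx M J, n k ≤ Fintype.card (X k)) ∧ y = corner p d q π := by
  -- channels of least total alphabet size among those with corner point `y`
  let Size : ℕ → Prop := fun s => ∃ (n : Fin M → ℕ) (q : ∀ k : AuxIdx M J, X k → Fin (n k) → ℝ),
    IsTestChannel q ∧ y = corner p d q π ∧ ∑ j : AuxIdx M J, n j = s
  have hex : ∃ s, Size s := by
    obtain ⟨n, q, hq, h⟩ := exists_eq_corner_of_mem_extremePoints hy
    exact ⟨_, n, q, hq, h, rfl⟩
  classical
  obtain ⟨n, q, hq, hyq, hs⟩ := Nat.find_spec hex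
  refine ⟨n, q, hq, fun k => ?_, hyq⟩
  by_contra! hk
  obtain ⟨c, hc, hc', z₀, hz₀⟩ := exists_isTilt (q := q) hk
  have hmem : ∀ c', IsTilt q k c' → corner p d (tilt q k c') π ∈ orthantRegion J p d π :=
    fun c' hc' => ⟨n, _, hc'.isTestChannel hq, fun _ => le_rfl, fun _ => le_rfl⟩
  have hty : corner p d (tilt q k c) π = y :=
    eq_of_mem_extremePoints_of_add_eq hy (hmem c hc) (hmem _ hc') (by
      rw [corner_tilt_add_corner_tilt_neg hp hq hd hc hc', ← hyq])
  obtain ⟨n', q', e, hres, hlt⟩ := exists_isRestriction (q := tilt q k c) (k := k) (z₀ := z₀)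
    fun x => by rw [tilt, Function.update_self, hz₀, zero_mul]
  have : ∀ l, Nonempty (W l) := fun l => (hd l).nonempty
  refine Nat.find_min hex (hlt.trans_eq hs)
    ⟨n', q', hres.isTestChannel (hc.isTestChannel hq), ?_, rfl⟩
  rw [hres.corner_eq, hty]

end ExtremePoints

end

end CanonicalBound

theorem mainTheorem2 {M L J : ℕ} (hJ : J ≤ M)
    {X : Fin M → Type*} {S V : Type*} {W : Fin L → Type*}
    [∀ k, Fintype (X k)] [Fintype S] [Fintype V]
    (p : (∀ k, X k) × S × V → ℝ) (hp : p ∈ stdSimplex ℝ ((∀ k, X k) × S × V))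
    (d : ∀ l, V → W l → ℝ) (dmax : Fin L → ℝ)
    (hd : ∀ l v w, d l v w ∈ Set.Icc 0 (dmax l))
    (hmin : ∀ l, ∀ μ ∈ stdSimplex ℝ V, ∃ w : W l,
      ∀ w' : W l, ∑ v, μ v * d l v w ≤ ∑ v, μ v * d l v w') :
    (∀ π : Equiv.Perm (Fin M),
      ∀ y ∈ Set.extremePoints ℝ (CanonicalBound.orthantRegion J p d π),
        ∃ (n : Fin M → ℕ) (q : ∀ k : CanonicalBound.AuxIdx M J, X k → Fin (n k) → ℝ),
          CanonicalBound.IsTestChannel q ∧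
          (∀ k : CanonicalBound.AuxIdx M J, n k ≤ Fintype.card (X k)) ∧
          y = CanonicalBound.corner p d q π) ∧
    convexHull ℝ (CanonicalBound.canonicalRegion J p d) =
      convexHull ℝ (⋃ π : Equiv.Perm (Fin M), CanonicalBound.orthantRegion J p d π) ∧
    Set.extremePoints ℝ (CanonicalBound.canonicalRegion J p d) ⊆
      ⋃ π : Equiv.Perm (Fin M), Set.extremePoints ℝ (CanonicalBound.orthantRegion J p d π) := by

  have : Nonempty V := by
    by_contra hV
    rw [not_nonempty_iff] at hV
    simpa using hp.2
  exact ⟨fun π y hy => CanonicalBound.exists_corner_eq_card_le hp.1 hmin hy,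
    CanonicalBound.convexHull_canonicalRegion hp.1 hmin,
    CanonicalBound.extremePoints_canonicalRegion_subset hp.1 hmin⟩
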